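/- Let $p$ be a prime. Matroids are not required to be finite, and a matroid is $\mathrm{GF}(p)$-representable if vectors of some $\mathrm{GF}(p)$-vector space can be assigned to its elements so that the independent sets are exactly the sets whose vectors form a linearly independent family. $M|F$ denotes the restriction of $M$ to $F$. For $k\ge 1$, $\mathrm{PG}(k-1,p)$ is the rank-$k$ matroid on the points of the $(k-1)$-dimensional projective space over $\mathrm{GF}(p)$, and $\mathrm{AG}(k-1,p)$ is the rank-$k$ matroid obtained from it by deleting the points of a hyperplane. (1) For every integer $k\ge 1$ there is an integer $N_p(k)$ such that every simple $\mathrm{GF}(p)$-representable matroid $M$ with $r(M)\ge N_p(k)$ has a rank-$k$ flat $F$ such that $F$ is independent in $M$, or $M|F\cong \mathrm{AG}(k-1,p)$, or $M|F\cong \mathrm{PG}(k-1,p)$. (2) For all integers $k,t\ge 1$ there is an integer $N_p(k,t)$ such that every simple $\mathrm{GF}(p)$-representable matroid $M$ with $r(M)\ge N_p(k,t)$ has either a rank-$t$ flat that is independent in $M$, or a rank-$k$ flat $F$ such that $M|F\cong \mathrm{AG}(k-1,p)$ or $M|F\cong \mathrm{PG}(k-1,p)$. (The alternatives are not exclusive.)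 -/

import Mathlib

open scoped LinearAlgebra.Projectivization Matroid

universe u v w

namespace Matroid

/-- The vector matroid of a family `x` of vectors: a set of indices is independent exactly when
the corresponding subfamily is linearly independent over `F`. -/
def vectorMatroid (F : Type v) [Field F] {α : Type u} {W : Type w} [AddCommGroup W] [Module F W]
    (x : α → W) : Matroid α :=
  (IndepMatroid.ofFinitaryCardAugment Set.univ (fun I => LinearIndepOn F x I)
    (linearIndepOn_empty F x)
    (fun _ _ hJ hIJ => hJ.mono hIJ)
    (by
      intro I J hI hIfin hJ hJfin hlt
      by_contra! hcon
      have hJI : ∀ e ∈ J, x e ∈ Submodule.span F (x '' I) := by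
        intro e he
        by_cases heI : e ∈ I
        · exact Submodule.subset_span (Set.mem_image_of_mem x heI)
        · by_contra hns
          exact hcon e he heI (hI.insert hns)
      have hle : Submodule.span F (x '' J) ≤ Submodule.span F (x '' I) :=
        Submodule.span_le.2 (by rintro _ ⟨e, he, rfl⟩; exact hJI e he)
      have card_eq : ∀ K : Set α, K.Finite → LinearIndepOn F x K →
          Module.finrank F (Submodule.span F (x '' K)) = K.ncard := by
        intro K hK hi
        have : Fintype K := hK.fintype
        have h := finrank_span_eq_card (R := F) (b := fun i : K => x i) hi
        rw [← Set.image_eq_range] at h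
        rw [h, ← Nat.card_coe_set_eq, Nat.card_eq_fintype_card]
      have : FiniteDimensional F (Submodule.span F (x '' I)) :=
        FiniteDimensional.span_of_finite F (hIfin.image x)
      have h := Submodule.finrank_mono hle
      rw [card_eq I hIfin hI, card_eq J hJfin hJ] at h
      omega)
    (fun I h => linearIndepOn_of_finite I (fun J hJ hfin => h J hJ hfin))
    (fun _ _ => Set.subset_univ _)).matroid

theorem vectorMatroid_ground (F : Type v) [Field F] {α : Type u} {W : Type w} [AddCommGroup W]
    [Module F W] (x : α → W) : (vectorMatroid F x).E = Set.univ := rfl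

theorem vectorMatroid_indep_iff (F : Type v) [Field F] {α : Type u} {W : Type w} [AddCommGroup W]
    [Module F W] (x : α → W) (I : Set α) :
    (vectorMatroid F x).Indep I ↔ LinearIndepOn F x I := by
  simp [vectorMatroid, IndepMatroid.ofFinitaryCardAugment, IndepMatroid.ofFinitary]

/-- `M` is representable over `F`: there is an assignment of vectors of some `F`-vector space to
the elements of `M` under which independence in `M` is linear independence. -/
def IsRepresentable {α : Type u} (M : Matroid α) (F : Type v) [Field F] : Prop :=
  ∃ (W : Type (max u v)) (_ : AddCommGroup W) (_ : Module F W) (x : α → W),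
    ∀ I ⊆ M.E, M.Indep I ↔ LinearIndepOn F x I

/-- `M` is simple: it has no loops (take `e = f`) and no parallel pairs. -/
def IsSimple {α : Type u} (M : Matroid α) : Prop :=
  ∀ e ∈ M.E, ∀ f ∈ M.E, M.Indep {e, f}

/-- Isomorphism of matroids: a bijection of the ground sets that preserves independence in both
directions. -/
def IsIsomorphic {α : Type u} {β : Type v} (M : Matroid α) (N : Matroid β) : Prop :=
  ∃ φ : M.E ≃ N.E, ∀ I : Set M.E,
    M.Indep (Subtype.val '' I) ↔ N.Indep (Subtype.val '' (φ '' I))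

/-- The projective geometry `PG(n, F)`, of rank `n + 1`: its elements are the points of the
`n`-dimensional projective space over `F`. -/
noncomputable def projectiveGeometry (n : ℕ) (F : Type v) [Field F] :
    Matroid (ℙ F (Fin (n + 1) → F)) :=
  vectorMatroid F (fun P : ℙ F (Fin (n + 1) → F) => P.rep)

/-- The affine geometry `AG(n, F)`, of rank `n + 1`: the projective geometry `PG(n, F)` with the
points of the hyperplane on which the coordinate `0` vanishes deleted. -/
noncomputable def affineGeometry (n : ℕ) (F : Type v) [Field F] :
    Matroid (ℙ F (Fin (n + 1) → F)) :=
  projectiveGeometry n F ↾ {P | P.rep 0 ≠ 0}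

end Matroid

/-! ### Rich sets and cubes on two scalars -/

/-- Every `t` linearly independent vectors of `X` have a linear combination in `X` with at least
two nonzero coefficients. -/
def CombinationRich {p : ℕ} (t : ℕ) {V : Type v} [AddCommGroup V] [Module (ZMod p) V]
    (X : Set V) : Prop :=
  ∀ x : Fin t → V, LinearIndependent (ZMod p) x → (∀ i, x i ∈ X) →
    ∃ c : Fin t → ZMod p, (∃ i j, i ≠ j ∧ c i ≠ 0 ∧ c j ≠ 0) ∧ ∑ i, c i • x i ∈ X

/-- `X` contains all sums `z + ∑ i, a i • y i` with coefficients `a i` in a fixed set of `s` scalars,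
for some linearly independent `z, y 0, …, y (n - 1)`. -/
def HasCube {p : ℕ} {V : Type v} [AddCommGroup V] [Module (ZMod p) V] (X : Set V)
    (s n : ℕ) : Prop :=
  ∃ e : Fin s → ZMod p, Function.Injective e ∧ ∃ (z : V) (y : Fin n → V),
    (∀ (l : ZMod p) (m : Fin n → ZMod p), l • z + ∑ i, m i • y i = 0 → l = 0 ∧ ∀ i, m i = 0) ∧
    ∀ w : Fin n → Fin s, z + ∑ i, e (w i) • y i ∈ X

/-- Combinations on `t` disjoint blocks of vectors, each of support at least `s`, are independent.
Richness applied to them merges at least two blocks, giving support at least `2 * s ≥ s + 1`. -/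
theorem CombinationRich.exists_large_support {p : ℕ} [Fact p.Prime] (t s : ℕ) (hs : 1 ≤ s) :
    ∃ n : ℕ, ∀ (V : Type v) [AddCommGroup V] [Module (ZMod p) V] (X : Set V),
      CombinationRich (p := p) t X → ∀ x : Fin n → V, LinearIndependent (ZMod p) x →
        (∀ i, x i ∈ X) →
        ∃ a : Fin n → ZMod p, s ≤ (Finset.univ.filter fun i => a i ≠ 0).card ∧
          ∑ i, a i • x i ∈ X := by
  induction s, hs using Nat.le_induction with
  | base =>
    refine ⟨1, fun V _ _ X _ x _ hx => ⟨fun _ => 1, ?_, ?_⟩⟩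
    · simp
    · simpa using hx 0
  | succ s hs ih =>
    obtain ⟨n, hn⟩ := ih
    refine ⟨t * n, fun V _ _ X hX x hli hx => ?_⟩
    let x' : Fin t → Fin n → V := fun i j => x (finProdFinEquiv (i, j))
    have hx' : ∀ i, LinearIndependent (ZMod p) (x' i) := fun i =>
      hli.comp _ (finProdFinEquiv.injective.comp (Prod.mk_right_injective i))
    choose a ha haX using fun i => hn V X hX (x' i) (hx' i) (fun j => hx _)
    have sum_eq : ∀ c : Fin t → ZMod p, ∑ i, c i • ∑ j, a i j • x' i j =
        ∑ k, (c (finProdFinEquiv.symm k).1 *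
          a (finProdFinEquiv.symm k).1 (finProdFinEquiv.symm k).2) • x k := by
      intro c
      rw [← finProdFinEquiv.sum_comp, Fintype.sum_prod_type]
      simp [x', Finset.smul_sum, smul_smul]
    have key : LinearIndependent (ZMod p) fun i => ∑ j, a i j • x' i j := by
      rw [Fintype.linearIndependent_iff] at hli ⊢
      intro c hc i
      rw [sum_eq] at hc
      have h := hli _ hc
      obtain ⟨j, hj⟩ : (Finset.univ.filter fun j => a i j ≠ 0).Nonempty := by
        rw [← Finset.card_pos]; have := ha i; omega
      have := h (finProdFinEquiv (i, j))
      simp only [Equiv.symm_apply_apply, mul_eq_zero] at this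
      exact this.resolve_right (by simpa using hj)
    obtain ⟨c, ⟨i₁, i₂, hi, h₁, h₂⟩, hc⟩ := hX _ key haX
    rw [sum_eq] at hc
    refine ⟨_, ?_, hc⟩
    have hsub : ∀ i, c i ≠ 0 → ((Finset.univ.filter fun j => a i j ≠ 0).image
        fun j => finProdFinEquiv (i, j)) ⊆ Finset.univ.filter fun k =>
          c (finProdFinEquiv.symm k).1 *
            a (finProdFinEquiv.symm k).1 (finProdFinEquiv.symm k).2 ≠ 0 := by
      intro i hci k hk
      simp only [Finset.mem_image, Finset.mem_filter, Finset.mem_univ, true_and] at hk ⊢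
      obtain ⟨j, hj, rfl⟩ := hk
      simp [hci, hj]
    have hcard : ∀ i, s ≤ ((Finset.univ.filter fun j => a i j ≠ 0).image
        fun j => finProdFinEquiv (i, j)).card := by
      intro i
      exact (ha i).trans_eq (Finset.card_image_of_injective _
        (finProdFinEquiv.injective.comp (Prod.mk_right_injective i))).symm
    have hdisj : Disjoint ((Finset.univ.filter fun j => a i₁ j ≠ 0).image
        fun j => finProdFinEquiv (i₁, j)) ((Finset.univ.filter fun j => a i₂ j ≠ 0).image
        fun j => finProdFinEquiv (i₂, j)) := by
      rw [Finset.disjoint_left]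
      intro k hk hk'
      simp only [Finset.mem_image] at hk hk'
      obtain ⟨j, -, rfl⟩ := hk
      obtain ⟨j', -, h⟩ := hk'
      exact hi (congrArg Prod.fst (finProdFinEquiv.injective h)).symm
    have := Finset.card_le_card (Finset.union_subset (hsub i₁ h₁) (hsub i₂ h₂))
    rw [Finset.card_union_of_disjoint hdisj] at this
    have h1 := hcard i₁
    have h2 := hcard i₂
    omega

/-- A product Ramsey theorem: a colouring of a large finite grid is constant on a product of
pairs. -/
theorem exists_mono_product_of_pairs (n : ℕ) (κ : Type w) [Finite κ] :
    ∃ L : ℕ, ∀ C : (Fin n → Fin L) → κ, ∃ σ : Fin n → Fin 2 → Fin L,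
      (∀ i, σ i 0 ≠ σ i 1) ∧ ∃ c, ∀ g : Fin n → Fin 2, C (fun i => σ i (g i)) = c := by
  induction n with
  | zero =>
    refine ⟨0, fun C => ⟨fun i => i.elim0, fun i => i.elim0, C fun i => i.elim0, fun g => ?_⟩⟩
    congr 1
    exact Subsingleton.elim _ _
  | succ n ih =>
    obtain ⟨L, hL⟩ := ih
    have : Fintype ((Fin n → Fin L) → κ) := Fintype.ofFinite _
    -- The first coordinate is coloured by the colouring it induces on the remaining grid; `L'`
    -- exceeds the number of such colourings, so two values `a`, `b` agree.
    let L' := max L (Fintype.card ((Fin n → Fin L) → κ) + 1)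
    have hLL : L ≤ L' := le_max_left _ _
    refine ⟨L', fun C => ?_⟩
    let D : Fin L' → (Fin n → Fin L) → κ := fun a g =>
      C (Fin.cons a fun i => Fin.castLE hLL (g i))
    obtain ⟨a, b, hab, hD⟩ := Fintype.exists_ne_map_eq_of_card_lt D (by
      rw [Fintype.card_fin]; exact lt_of_lt_of_le (Nat.lt_succ_self _) (le_max_right _ _))
    obtain ⟨σ, hσ, c, hc⟩ := hL (D a)
    refine ⟨Fin.cons ![a, b] fun i j => Fin.castLE hLL (σ i j), ?_, c, fun g => ?_⟩
    · intro i
      refine Fin.cases ?_ (fun i => ?_) i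
      · simpa using hab
      · simpa using hσ i
    · have hg : (fun i => (Fin.cons ![a, b] (fun i j => Fin.castLE hLL (σ i j)) :
          Fin (n + 1) → Fin 2 → Fin L') i (g i)) =
          Fin.cons (![a, b] (g 0)) fun i => Fin.castLE hLL (σ i (g i.succ)) := by
        funext i
        refine Fin.cases ?_ (fun i => ?_) i <;> simp
      rw [hg, ← hc fun i => g i.succ]
      rcases Fin.exists_fin_two.1 ⟨g 0, rfl⟩ with h | h
      · rw [h]; rfl
      · rw [h]; exact (congrFun hD _).symm

/-- Each choice of one vector per block is coloured by the coefficients of a large-support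
combination in `X`. On a monochromatic product of pairs, switching the vector in block `i` adds the
fixed vector `a i • (b i (σ i 1) - b i (σ i 0))`; these are the cube directions. -/
theorem CombinationRich.exists_hasCube_two {p : ℕ} [Fact p.Prime] (t n : ℕ) :
    ∃ N : ℕ, ∀ (V : Type v) [AddCommGroup V] [Module (ZMod p) V] (X : Set V),
      CombinationRich (p := p) t X → ∀ x : Fin N → V, LinearIndependent (ZMod p) x →
        (∀ i, x i ∈ X) → HasCube (p := p) X 2 n := by
  obtain ⟨r, hr⟩ := CombinationRich.exists_large_support.{v} (p := p) t (n + 1) (by omega)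
  obtain ⟨L, hL⟩ := exists_mono_product_of_pairs r (Fin r → ZMod p)
  refine ⟨r * L, fun V _ _ X hX x hli hx => ?_⟩
  let b : Fin r → Fin L → V := fun i j => x (finProdFinEquiv (i, j))
  have hinj : ∀ g : Fin r → Fin L, Function.Injective fun i => finProdFinEquiv (i, g i) :=
    fun g i j h => congrArg Prod.fst (finProdFinEquiv.injective h)
  choose C hC hCX using fun g : Fin r → Fin L =>
    hr V X hX (fun i => b i (g i)) (hli.comp _ (hinj g)) (fun i => hx _)
  obtain ⟨σ, hσ, a, ha⟩ := hL C
  have hcard := hC (fun i => σ i 0)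
  rw [ha fun _ => 0] at hcard
  have haX : ∀ g : Fin r → Fin 2, ∑ i, a i • b i (σ i (g i)) ∈ X := by
    intro g
    have := hCX (fun i => σ i (g i))
    rwa [ha g] at this
  -- Of the `n + 1` support indices, `f 0` is kept out of all directions, which forces the
  -- coefficient of `z` in any relation to vanish.
  obtain ⟨f⟩ : Nonempty (Fin (n + 1) ↪ {i // a i ≠ 0}) := by
    apply Function.Embedding.nonempty_of_card_le
    rw [Fintype.card_subtype, Fintype.card_fin]
    exact hcard
  let f' : Fin n → Fin r := fun j => (f j.succ).1
  have hf' : Function.Injective f' := fun i j h =>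
    Fin.succ_injective _ (f.injective (Subtype.ext h))
  have hf0 : ∀ j, f' j ≠ (f 0).1 := fun j h =>
    Fin.succ_ne_zero j (f.injective (Subtype.ext h))
  have hb : ∀ l : Fin r → Fin L → ZMod p, ∑ i, ∑ j, l i j • b i j = 0 → ∀ i j, l i j = 0 := by
    intro l hl i j
    rw [Fintype.linearIndependent_iff] at hli
    have := hli (fun k => l (finProdFinEquiv.symm k).1 (finProdFinEquiv.symm k).2) (by
      rw [← finProdFinEquiv.sum_comp, Fintype.sum_prod_type]
      simpa [b] using hl) (finProdFinEquiv (i, j))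
    simpa using this
  have hb2 : ∀ l m : Fin r → ZMod p,
      ∑ i, (l i • b i (σ i 0) + m i • b i (σ i 1)) = 0 → ∀ i, l i = 0 ∧ m i = 0 := by
    intro l m h i
    have h' := hb (fun i j => (if j = σ i 0 then l i else 0) + (if j = σ i 1 then m i else 0)) (by
      simpa [add_smul, Finset.sum_add_distrib, ite_smul] using h) i
    exact ⟨by simpa [hσ i] using h' (σ i 0), by simpa [(hσ i).symm] using h' (σ i 1)⟩
  refine ⟨![0, 1], ?_, ∑ i, a i • b i (σ i 0),
    fun j => a (f' j) • (b (f' j) (σ (f' j) 1) - b (f' j) (σ (f' j) 0)), ?_, ?_⟩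
  · intro i j
    fin_cases i <;> fin_cases j <;> simp
  · intro l m h
    have hs : ∑ j, m j • a (f' j) • (b (f' j) (σ (f' j) 1) - b (f' j) (σ (f' j) 0)) =
        ∑ i, (∑ j, if f' j = i then m j else 0) • a i • (b i (σ i 1) - b i (σ i 0)) := by
      simp_rw [Finset.sum_smul]
      rw [Finset.sum_comm]
      simp [ite_smul]
    rw [hs, Finset.smul_sum, ← Finset.sum_add_distrib] at h
    have h' := hb2 (fun i => l * a i - (∑ j, if f' j = i then m j else 0) * a i)
      (fun i => (∑ j, if f' j = i then m j else 0) * a i) (by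
        rw [← h]
        refine Finset.sum_congr rfl fun i _ => ?_
        module)
    have hl : l = 0 := by
      have := (h' (f 0).1).1
      simp only [hf0, if_false, Finset.sum_const_zero, zero_mul, sub_zero, mul_eq_zero] at this
      exact this.resolve_right (f 0).2
    refine ⟨hl, fun j => ?_⟩
    have := (h' (f' j)).2
    simp only [hf'.eq_iff, Finset.sum_ite_eq', Finset.mem_univ, if_true, mul_eq_zero] at this
    exact this.resolve_right (f j.succ).2
  · intro w
    have := haX fun i => if ∃ j, f' j = i ∧ w j = 1 then 1 else 0
    convert this using 1
    have hs : ∑ j, (![0, 1] : Fin 2 → ZMod p) (w j) •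
          a (f' j) • (b (f' j) (σ (f' j) 1) - b (f' j) (σ (f' j) 0)) =
        ∑ i, (if ∃ j, f' j = i ∧ w j = 1 then (1 : ZMod p) else 0) •
          a i • (b i (σ i 1) - b i (σ i 0)) := by
      have : ∀ i, (if ∃ j, f' j = i ∧ w j = 1 then (1 : ZMod p) else 0) =
          ∑ j, if f' j = i then (![0, 1] : Fin 2 → ZMod p) (w j) else 0 := by
        intro i
        by_cases hi : ∃ j, f' j = i
        · obtain ⟨j, rfl⟩ := hi
          simp only [hf'.eq_iff, Finset.sum_ite_eq', Finset.mem_univ, if_true, exists_eq_left]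
          rcases Fin.exists_fin_two.1 ⟨w j, rfl⟩ with h | h <;> simp [h]
        · push Not at hi
          simp [hi]
      simp_rw [this, Finset.sum_smul]
      rw [Finset.sum_comm]
      simp [ite_smul]
    rw [hs, ← Finset.sum_add_distrib]
    refine Finset.sum_congr rfl fun i _ => ?_
    split_ifs <;> simp [smul_sub]

/-! ### Enlarging the scalar set up to the whole field -/

/-- Parametrisation of weighted sums along a combinatorial subspace. -/
theorem Combinatorics.Subspace.sum_smul {R V η α ι : Type*} [CommRing R] [AddCommGroup V]
    [Module R V] [Fintype ι] [Fintype η] [DecidableEq α] [DecidableEq η]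
    (l : Combinatorics.Subspace η α ι) (f : α → R) (y : ι → V) (x : η → α) :
    ∑ i, f (l x i) • y i = ∑ i, Sum.elim f (fun _ => 0) (l.idxFun i) • y i +
      ∑ e, f (x e) • ∑ i, (if l.idxFun i = Sum.inr e then (1 : R) else 0) • y i := by
  simp_rw [Finset.smul_sum]
  rw [Finset.sum_comm, ← Finset.sum_add_distrib]
  refine Finset.sum_congr rfl fun i _ => ?_
  rcases h : l.idxFun i with a | e
  · simp [Combinatorics.Subspace.apply_inl h]
  · simp [Combinatorics.Subspace.apply_inr h]

theorem Combinatorics.Subspace.sum_smul_direction {R V η α ι : Type*} [CommRing R]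
    [AddCommGroup V] [Module R V] [Fintype ι] [Fintype η] [DecidableEq α] [DecidableEq η]
    (l : Combinatorics.Subspace η α ι) (m : η → R) (y : ι → V) :
    ∑ e, m e • ∑ i, (if l.idxFun i = Sum.inr e then (1 : R) else 0) • y i =
      ∑ i, Sum.elim (fun _ => 0) m (l.idxFun i) • y i := by
  simp_rw [Finset.smul_sum]
  rw [Finset.sum_comm]
  refine Finset.sum_congr rfl fun i _ => ?_
  rcases h : l.idxFun i with a | e <;> simp

open scoped Pointwise in
/-- A nondegenerate linear form takes at least `s + 1` values on a grid of side `s < p`. -/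
theorem ZMod.lt_card_image_sum_mul {p : ℕ} [hp : Fact p.Prime] {t s : ℕ} (hs : 2 ≤ s) (hsp : s < p)
    (e : Fin s → ZMod p) (he : Function.Injective e) (c : Fin t → ZMod p)
    (hc : ∃ i j, i ≠ j ∧ c i ≠ 0 ∧ c j ≠ 0) :
    s + 1 ≤ (Finset.univ.image fun w : Fin t → Fin s => ∑ j, c j * e (w j)).card := by
  obtain ⟨i, j, hij, hi, hj⟩ := hc
  let o : Fin s := ⟨0, by omega⟩
  -- Subtracting `e o` lets every coordinate other than `i` and `j` rest at `o` and contribute 0, up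
  -- to one common translation.
  let A : Fin t → Finset (ZMod p) := fun i => Finset.univ.image fun k => c i * (e k - e o)
  have hA : ∀ i, c i ≠ 0 → (A i).card = s := by
    intro i hi
    rw [Finset.card_image_of_injective, Finset.card_univ, Fintype.card_fin]
    intro k l h
    exact he (sub_left_injective (mul_left_cancel₀ hi h))
  have hne : ∀ i, (A i).Nonempty := fun i => ⟨_, Finset.mem_image_of_mem _ (Finset.mem_univ o)⟩
  have hcd := ZMod.cauchy_davenport hp.out (hne i) (hne j)
  rw [hA i hi, hA j hj] at hcd
  -- Cauchy–Davenport gives `min p (2 * s - 1)`: the first term uses `s < p`, the second `2 ≤ s`.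
  have hle : s + 1 ≤ (A i + A j).card := le_trans (le_min (by omega) (by omega)) hcd
  refine hle.trans ?_
  rw [← Finset.card_image_of_injective (A i + A j) (add_left_injective (∑ k, c k * e o))]
  refine Finset.card_le_card fun v hv => ?_
  simp only [Finset.mem_image, Finset.mem_add, A, Finset.mem_univ, true_and] at hv ⊢
  obtain ⟨_, ⟨_, ⟨k, rfl⟩, _, ⟨l, rfl⟩, rfl⟩, rfl⟩ := hv
  refine ⟨fun r => if r = i then k else if r = j then l else o, ?_⟩
  have : ∀ r, c r * e (if r = i then k else if r = j then l else o) =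
      (if r = i then c r * (e k - e o) else 0) + (if r = j then c r * (e l - e o) else 0) +
        c r * e o := by
    intro r
    by_cases h1 : r = i
    · subst h1; simp [hij]; ring
    · by_cases h2 : r = j
      · subst h2; simp [h1]; ring
      · simp [h1, h2]
  simp [this, Finset.sum_add_distrib]

/-- A letter in `Fin t → Fin s` encodes one coordinate of `t` cube points at once, so a word of
length `m` encodes `t` points of `X`. Along a combinatorial subspace where richness returns a
constant `c`, each direction carries the coefficient `∑ j, c j * e (w j)` with `w` free, and this
takes at least `s + 1` values. -/
theorem HasCube.exists_enlarge {p : ℕ} [Fact p.Prime] (t n : ℕ) {s : ℕ} (hs : 2 ≤ s)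
    (hsp : s < p) :
    ∃ N : ℕ, ∀ (V : Type v) [AddCommGroup V] [Module (ZMod p) V] (X : Set V),
      CombinationRich (p := p) t X → HasCube (p := p) X s N → HasCube (p := p) X (s + 1) n := by
  obtain ⟨m, hm⟩ := Combinatorics.Subspace.exists_mono_in_high_dimension_fin
    (Fin t → Fin s) (Fin t → ZMod p) (Fin n)
  refine ⟨m + t, fun V _ _ X hX => ?_⟩
  rintro ⟨e, he, z, y, hzy, hcube⟩
  let r₀ : Fin s := ⟨0, by omega⟩
  let r₁ : Fin s := ⟨1, by omega⟩
  have hr : e r₁ - e r₀ ≠ 0 := by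
    rw [sub_ne_zero]
    intro h
    simpa [r₀, r₁] using he h
  -- The last `t` coordinates carry an identity pattern: point `j` has `r₁` in place `j` and `r₀`
  -- elsewhere. This makes the `t` points independent whatever `g` is.
  let W : (Fin m → Fin t → Fin s) → Fin t → Fin (m + t) → Fin s := fun g j =>
    Fin.append (fun i => g i j) (fun r => if r = j then r₁ else r₀)
  let x : (Fin m → Fin t → Fin s) → Fin t → V := fun g j => z + ∑ i, e (W g j i) • y i
  have hx : ∀ g (c : Fin t → ZMod p), ∑ j, c j • x g j = (∑ j, c j) • z +
      (∑ i, (∑ j, c j * e (g i j)) • y (Fin.castAdd t i) +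
        ∑ r, ((∑ j, c j) * e r₀ + c r * (e r₁ - e r₀)) • y (Fin.natAdd m r)) := by
    intro g c
    have h1 : ∀ j, x g j = z + (∑ i, e (g i j) • y (Fin.castAdd t i) +
        ∑ r, (e r₀ + if r = j then e r₁ - e r₀ else 0) • y (Fin.natAdd m r)) := by
      intro j
      simp only [x, W, Fin.sum_univ_add, Fin.append_left, Fin.append_right]
      congr 2
      refine Finset.sum_congr rfl fun r _ => ?_
      split_ifs <;> simp
    simp only [h1, smul_add, Finset.sum_add_distrib, Finset.sum_smul, Finset.smul_sum]
    congr 1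
    congr 1
    · rw [Finset.sum_comm]
      simp [smul_smul]
    · rw [Finset.sum_comm]
      refine Finset.sum_congr rfl fun r _ => ?_
      simp [add_smul, smul_smul, ite_smul, Finset.sum_add_distrib, Finset.sum_smul,
        Finset.sum_mul]
  have hzy' : ∀ (l : ZMod p) (a : Fin m → ZMod p) (b : Fin t → ZMod p),
      l • z + (∑ i, a i • y (Fin.castAdd t i) + ∑ r, b r • y (Fin.natAdd m r)) = 0 →
        l = 0 ∧ (∀ i, a i = 0) ∧ ∀ r, b r = 0 := by
    intro l a b h
    have := hzy l (Fin.append a b) (by simpa [Fin.sum_univ_add] using h)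
    exact ⟨this.1, fun i => by simpa using this.2 (Fin.castAdd t i),
      fun r => by simpa using this.2 (Fin.natAdd m r)⟩
  have hc0 : ∀ c : Fin t → ZMod p, ∀ r, (∑ j, c j) = 0 →
      (∑ j, c j) * e r₀ + c r * (e r₁ - e r₀) = 0 → c r = 0 := by
    intro c r h1 h2
    rw [h1, zero_mul, zero_add] at h2
    exact (mul_eq_zero.1 h2).resolve_right hr
  have hli : ∀ g, LinearIndependent (ZMod p) (x g) := by
    intro g
    rw [Fintype.linearIndependent_iff]
    intro c hc r
    rw [hx] at hc
    obtain ⟨h1, -, h2⟩ := hzy' _ _ _ hc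
    exact hc0 c r h1 (h2 r)
  choose C hC hCX using fun g => hX (x g) (hli g) (fun j => hcube _)
  obtain ⟨l, c, hl⟩ := hm C
  have hc : ∃ i j, i ≠ j ∧ c i ≠ 0 ∧ c j ≠ 0 := hl (fun _ _ => r₀) ▸ hC _
  have hmem : ∀ q : Fin n → Fin t → Fin s, ∑ j, c j • x (l q) j ∈ X := by
    intro q
    have := hCX (l q)
    rwa [hl q] at this
  let f : (Fin t → Fin s) → ZMod p := fun w => ∑ j, c j * e (w j)
  obtain ⟨e'⟩ : Nonempty (Fin (s + 1) ↪ Finset.univ.image f) := by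
    apply Function.Embedding.nonempty_of_card_le
    rw [Fintype.card_coe, Fintype.card_fin]
    exact ZMod.lt_card_image_sum_mul hs hsp e he c hc
  have he' : ∀ k, ∃ w, f w = (e' k : ZMod p) := by
    intro k
    obtain ⟨w, -, hw⟩ := Finset.mem_image.1 (e' k).2
    exact ⟨w, hw⟩
  choose q hq using he'
  let B : Fin t → ZMod p := fun r => (∑ j, c j) * e r₀ + c r * (e r₁ - e r₀)
  refine ⟨fun k => e' k, fun a b h => e'.injective (Subtype.ext h),
    (∑ j, c j) • z + (∑ i, Sum.elim f (fun _ => 0) (l.idxFun i) • y (Fin.castAdd t i) +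
      ∑ r, B r • y (Fin.natAdd m r)),
    fun k => ∑ i, (if l.idxFun i = Sum.inr k then (1 : ZMod p) else 0) • y (Fin.castAdd t i),
    ?_, ?_⟩
  · intro d a h
    rw [l.sum_smul_direction a fun i => y (Fin.castAdd t i)] at h
    obtain ⟨h1, h2, h3⟩ := hzy' (d * ∑ j, c j) (fun i => d * Sum.elim f (fun _ => 0) (l.idxFun i) +
      Sum.elim (fun _ => 0) a (l.idxFun i)) (fun r => d * B r) (by
        rw [← h]
        simp only [add_smul, mul_smul, Finset.sum_add_distrib, ← Finset.smul_sum]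
        module)
    -- The sum `∑ j, c j` may be 0; the identity coordinates then still keep the new base point
    -- outside the span of the directions.
    have hd : d = 0 := by
      by_contra hd
      obtain ⟨i, -, -, hi, -⟩ := hc
      exact hi (hc0 c i ((mul_eq_zero.1 h1).resolve_left hd)
        ((mul_eq_zero.1 (h3 i)).resolve_left hd))
    refine ⟨hd, fun k => ?_⟩
    obtain ⟨i, hi⟩ := l.proper k
    simpa [hi, hd] using h2 i
  · intro w
    convert hmem (fun k => q (w k)) using 1
    rw [hx]
    have := l.sum_smul f (fun i => y (Fin.castAdd t i)) fun k => q (w k)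
    simp only [hq] at this
    rw [show ∑ i, (∑ j, c j * e (l (fun k => q (w k)) i j)) • y (Fin.castAdd t i) =
      ∑ i, f (l (fun k => q (w k)) i) • y (Fin.castAdd t i) from rfl, this]
    abel

/-- Once `s = p`, the injection `e` is onto `ZMod p`, so the cube is a full affine space. -/
theorem CombinationRich.exists_affine {p : ℕ} [hp : Fact p.Prime] (t n : ℕ) :
    ∃ N : ℕ, ∀ (V : Type v) [AddCommGroup V] [Module (ZMod p) V] (X : Set V),
      CombinationRich (p := p) t X → ∀ x : Fin N → V, LinearIndependent (ZMod p) x →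
        (∀ i, x i ∈ X) → ∃ (z : V) (y : Fin n → V), LinearIndependent (ZMod p) y ∧
          z ∉ Submodule.span (ZMod p) (Set.range y) ∧
          ∀ u ∈ Submodule.span (ZMod p) (Set.range y), z + u ∈ X := by
  have key : ∀ s, 2 ≤ s → s ≤ p → ∀ n, ∃ N : ℕ, ∀ (V : Type v) [AddCommGroup V]
      [Module (ZMod p) V] (X : Set V),
      CombinationRich (p := p) t X → ∀ x : Fin N → V, LinearIndependent (ZMod p) x →
        (∀ i, x i ∈ X) → HasCube (p := p) X s n := by
    intro s hs
    induction s, hs using Nat.le_induction with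
    | base => exact fun _ n => CombinationRich.exists_hasCube_two t n
    | succ s hs ih =>
      intro hsp n
      obtain ⟨m, hm⟩ := HasCube.exists_enlarge.{v} (p := p) t n hs hsp
      obtain ⟨N, hN⟩ := ih (by omega) m
      exact ⟨N, fun V _ _ X hX x hli hx => hm V X hX (hN V X hX x hli hx)⟩
  obtain ⟨N, hN⟩ := key p hp.out.two_le le_rfl n
  refine ⟨N, fun V _ _ X hX x hli hx => ?_⟩
  obtain ⟨e, he, z, y, hzy, hcube⟩ := hN V X hX x hli hx
  have hes : Function.Surjective e :=
    ((Fintype.bijective_iff_injective_and_card e).2 ⟨he, by simp [ZMod.card]⟩).2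
  refine ⟨z, y, ?_, ?_, ?_⟩
  · rw [Fintype.linearIndependent_iff]
    intro m hm
    exact (hzy 0 m (by simpa using hm)).2
  · intro hz
    obtain ⟨m, hm⟩ := (Submodule.mem_span_range_iff_exists_fun _).1 hz
    have := (hzy (-1) m (by rw [hm]; simp)).1
    simp at this
  · intro u hu
    obtain ⟨m, rfl⟩ := (Submodule.mem_span_range_iff_exists_fun _).1 hu
    choose w hw using fun i => hes (m i)
    simpa [hw] using hcube w

/-! ### Monochromatic subspaces -/

/-- With the field itself as alphabet, a combinatorial subspace of the coordinate grid parametrises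
an affine subspace. -/
theorem exists_mono_affine_subspace {F : Type} [Field F] [Finite F] (r : ℕ) :
    ∃ n : ℕ, ∀ (V : Type v) [AddCommGroup V] [Module F V] (X : Set V) (z : V) (y : Fin n → V),
      LinearIndependent F y → ∃ d ∈ Submodule.span F (Set.range y), ∃ y' : Fin r → V,
        LinearIndependent F y' ∧ Submodule.span F (Set.range y') ≤ Submodule.span F (Set.range y) ∧
        ((∀ u ∈ Submodule.span F (Set.range y'), z + d + u ∈ X) ∨
          ∀ u ∈ Submodule.span F (Set.range y'), z + d + u ∉ X) := by
  classical
  obtain ⟨n, hn⟩ := Combinatorics.Subspace.exists_mono_in_high_dimension_fin F Prop (Fin r)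
  refine ⟨n, fun V _ _ X z y hy => ?_⟩
  have hspan : ∀ a : Fin n → F, ∑ i, a i • y i ∈ Submodule.span F (Set.range y) := fun a =>
    Submodule.sum_mem _ fun i _ => Submodule.smul_mem _ _ (Submodule.subset_span ⟨i, rfl⟩)
  obtain ⟨l, c, hl⟩ := hn fun a => z + ∑ i, a i • y i ∈ X
  refine ⟨_, hspan fun i => Sum.elim id (fun _ => 0) (l.idxFun i),
    fun e => ∑ i, (if l.idxFun i = Sum.inr e then (1 : F) else 0) • y i, ?_, ?_, ?_⟩
  · rw [Fintype.linearIndependent_iff] at hy ⊢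
    intro m hm e
    rw [l.sum_smul_direction] at hm
    obtain ⟨i, hi⟩ := l.proper e
    simpa [hi] using hy _ hm i
  · rw [Submodule.span_le]
    rintro _ ⟨e, rfl⟩
    exact hspan _
  · have h : ∀ u ∈ Submodule.span F (Set.range fun e => ∑ i, (if l.idxFun i = Sum.inr e then
        (1 : F) else 0) • y i), (z + ∑ i, Sum.elim id (fun _ => 0) (l.idxFun i) • y i + u ∈ X) = c := by
      intro u hu
      obtain ⟨m, rfl⟩ := (Submodule.mem_span_range_iff_exists_fun _).1 hu
      rw [← hl m]
      have := l.sum_smul id y m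
      simp only [id] at this
      rw [add_assoc, ← this]
    by_cases hc : c
    · exact Or.inl fun u hu => (h u hu).symm ▸ hc
    · exact Or.inr fun u hu => (h u hu).symm ▸ hc

/-- The Graham–Leeb–Rothschild theorem for points and two colours. -/
theorem exists_mono_subspace {F : Type} [Field F] [Finite F] (a b : ℕ) :
    ∃ n : ℕ, ∀ (V : Type v) [AddCommGroup V] [Module F V] (X : Set V),
      (∀ (c : F) (v : V), c ≠ 0 → v ∈ X → c • v ∈ X) → ∀ y : Fin n → V, LinearIndependent F y →
      (∃ y' : Fin a → V, LinearIndependent F y' ∧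
        Submodule.span F (Set.range y') ≤ Submodule.span F (Set.range y) ∧
        ∀ u ∈ Submodule.span F (Set.range y'), u ≠ 0 → u ∈ X) ∨
      (∃ y' : Fin b → V, LinearIndependent F y' ∧
        Submodule.span F (Set.range y') ≤ Submodule.span F (Set.range y) ∧
        ∀ u ∈ Submodule.span F (Set.range y'), u ≠ 0 → u ∉ X) := by
  induction hs : a + b generalizing a b with
  | zero =>
    obtain rfl : a = 0 := by omega
    refine ⟨0, fun V _ _ X _ y _ => Or.inl ⟨Fin.elim0, linearIndependent_empty_type, ?_, ?_⟩⟩ <;>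
      simp
  | succ s ih =>
    rcases a with _ | a
    · refine ⟨0, fun V _ _ X _ y _ => Or.inl ⟨Fin.elim0, linearIndependent_empty_type, ?_, ?_⟩⟩ <;>
        simp
    rcases b with _ | b
    · refine ⟨0, fun V _ _ X _ y _ => Or.inr ⟨Fin.elim0, linearIndependent_empty_type, ?_, ?_⟩⟩ <;>
        simp
    obtain ⟨n₁, h₁⟩ := ih a (b + 1) (by omega)
    obtain ⟨n₂, h₂⟩ := ih (a + 1) b (by omega)
    -- The plan is to find a monochromatic coset `y 0 + d + span q` off the origin, then apply
    -- induction inside `span q`, with the target for the coset's colour lowered by one.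
    obtain ⟨n, hn⟩ := exists_mono_affine_subspace.{v} (F := F) (max n₁ n₂)
    refine ⟨n + 1, fun V _ _ X hX y hy => ?_⟩
    obtain ⟨hy0, hz⟩ := linearIndependent_finSucc.1 hy
    have htail : Submodule.span F (Set.range (Fin.tail y)) ≤ Submodule.span F (Set.range y) :=
      Submodule.span_mono (by rintro _ ⟨i, rfl⟩; exact ⟨i.succ, rfl⟩)
    obtain ⟨d, hd, q, hq, hqy, hmono⟩ := hn V X (y 0) (Fin.tail y) hy0
    have hv : y 0 + d ∉ Submodule.span F (Set.range (Fin.tail y)) := fun h =>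
      hz (by simpa using Submodule.sub_mem _ h hd)
    have hvy : y 0 + d ∈ Submodule.span F (Set.range y) :=
      Submodule.add_mem _ (Submodule.subset_span ⟨0, rfl⟩) (htail hd)
    have hcast : ∀ {k : ℕ} (hk : k ≤ max n₁ n₂),
        LinearIndependent F (fun i => q (Fin.castLE hk i)) ∧
        Submodule.span F (Set.range fun i => q (Fin.castLE hk i)) ≤
          Submodule.span F (Set.range q) := fun hk =>
      ⟨hq.comp _ (Fin.castLE_injective hk),
        Submodule.span_mono (by rintro _ ⟨i, rfl⟩; exact ⟨_, rfl⟩)⟩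
    -- A vector of the enlarged span outside `span w` is a nonzero multiple of a coset vector, so it
    -- has the coset's colour. `Y` will be `X` or `Xᶜ`.
    have extend : ∀ {k : ℕ} (Y : Set V) (w : Fin k → V), LinearIndependent F w →
        Submodule.span F (Set.range w) ≤ Submodule.span F (Set.range q) →
        (∀ (c : F) (v : V), c ≠ 0 → v ∈ Y → c • v ∈ Y) →
        (∀ u ∈ Submodule.span F (Set.range q), y 0 + d + u ∈ Y) →
        (∀ u ∈ Submodule.span F (Set.range w), u ≠ 0 → u ∈ Y) →
        ∃ y' : Fin (k + 1) → V, LinearIndependent F y' ∧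
        Submodule.span F (Set.range y') ≤ Submodule.span F (Set.range y) ∧
        ∀ u ∈ Submodule.span F (Set.range y'), u ≠ 0 → u ∈ Y := by
      intro k Y w hw hwq hY hqY hwY
      refine ⟨Fin.cons (y 0 + d) w, linearIndependent_finCons.2
        ⟨hw, fun h => hv (hqy (hwq h))⟩, ?_, ?_⟩
      · rw [Submodule.span_le, Fin.range_cons, Set.insert_subset_iff]
        exact ⟨hvy, fun v hv => htail (hqy (hwq (Submodule.subset_span hv)))⟩
      · intro u hu hu0
        rw [Fin.range_cons, Submodule.mem_span_insert] at hu
        obtain ⟨c, v, hv, rfl⟩ := hu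
        by_cases hc : c = 0
        · subst hc
          rw [zero_smul, zero_add] at hu0 ⊢
          exact hwY v hv hu0
        · have := hY c _ hc (hqY (c⁻¹ • v) (Submodule.smul_mem _ _ (hwq hv)))
          rwa [smul_add, smul_inv_smul₀ hc] at this
    rcases hmono with hmono | hmono
    · obtain ⟨hc, hcq⟩ := hcast (le_max_left n₁ n₂)
      rcases h₁ V X hX _ hc with ⟨w, hw, hwq, hwX⟩ | ⟨w, hw, hwq, hwX⟩
      · exact Or.inl (extend X w hw (hwq.trans hcq) hX hmono hwX)
      · exact Or.inr ⟨w, hw, ((hwq.trans hcq).trans hqy).trans htail, hwX⟩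
    · obtain ⟨hc, hcq⟩ := hcast (le_max_right n₁ n₂)
      rcases h₂ V X hX _ hc with ⟨w, hw, hwq, hwX⟩ | ⟨w, hw, hwq, hwX⟩
      · exact Or.inl ⟨w, hw, ((hwq.trans hcq).trans hqy).trans htail, hwX⟩
      · refine Or.inr (extend Xᶜ w hw (hwq.trans hcq) (fun c v hc hv h => hv ?_) hmono hwX)
        have := hX c⁻¹ _ (inv_ne_zero hc) h
        rwa [inv_smul_smul₀ hc] at this

theorem CombinationRich.exists_geometry {p : ℕ} [Fact p.Prime] (t k : ℕ) :
    ∃ N : ℕ, ∀ (V : Type v) [AddCommGroup V] [Module (ZMod p) V] (X : Set V),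
      (∀ (c : ZMod p) (v : V), c ≠ 0 → v ∈ X → c • v ∈ X) →
      CombinationRich (p := p) t X → ∀ x : Fin N → V, LinearIndependent (ZMod p) x →
        (∀ i, x i ∈ X) → ∃ (z : V) (y : Fin k → V), LinearIndependent (ZMod p) y ∧
          z ∉ Submodule.span (ZMod p) (Set.range y) ∧
          (∀ u ∈ Submodule.span (ZMod p) (Set.range y), z + u ∈ X) ∧
          ((∀ u ∈ Submodule.span (ZMod p) (Set.range y), u ≠ 0 → u ∈ X) ∨
            ∀ u ∈ Submodule.span (ZMod p) (Set.range y), u ≠ 0 → u ∉ X) := by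
  obtain ⟨n, hn⟩ := exists_mono_subspace.{v} (F := ZMod p) k k
  obtain ⟨N, hN⟩ := CombinationRich.exists_affine.{v} (p := p) t n
  refine ⟨N, fun V _ _ X hX hr x hli hx => ?_⟩
  obtain ⟨z, y, hy, hz, hzX⟩ := hN V X hr x hli hx
  rcases hn V X hX y hy with ⟨w, hw, hwy, hwX⟩ | ⟨w, hw, hwy, hwX⟩
  · exact ⟨z, w, hw, fun h => hz (hwy h), fun u hu => hzX u (hwy hu), Or.inl hwX⟩
  · exact ⟨z, w, hw, fun h => hz (hwy h), fun u hu => hzX u (hwy hu), Or.inr hwX⟩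

/-! ### From vectors back to flats -/

namespace Matroid

section Representation

variable {α : Type u} {K : Type v} {W : Type w} [Field K] [AddCommGroup W] [Module K W]

/-- The nonzero multiples of the vectors representing the elements of `M`. -/
def representedVectors (K : Type v) [Field K] [Module K W] (M : Matroid α) (x : α → W) : Set W :=
  {v | ∃ f ∈ M.E, ∃ c : K, c ≠ 0 ∧ v = c • x f}

theorem IsSimple.eq_of_eq_smul {M : Matroid α} (hM : M.IsSimple) {x : α → W}
    (hx : ∀ I ⊆ M.E, M.Indep I ↔ LinearIndepOn K x I) {f g : α} (hf : f ∈ M.E) (hg : g ∈ M.E)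
    {c : K} (h : x f = c • x g) : f = g := by
  by_contra hne
  have hli := (hx _ (Set.insert_subset hf (Set.singleton_subset_iff.2 hg))).1 (hM f hf g hg)
  rw [LinearIndepOn.pair_iff x hne] at hli
  simpa using (hli 1 (-c) (by rw [h]; module)).1

theorem IsSimple.vector_ne_zero {M : Matroid α} (hM : M.IsSimple) {x : α → W}
    (hx : ∀ I ⊆ M.E, M.Indep I ↔ LinearIndepOn K x I) {f : α} (hf : f ∈ M.E) : x f ≠ 0 := by
  have hli := (hx _ (Set.insert_subset hf (Set.singleton_subset_iff.2 hf))).1 (hM f hf f hf)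
  exact hli.ne_zero (i := f) (by simp)

/-- The elements of `M` in the span of `k` independent ones form a flat of rank `k`. -/
theorem isFlat_eRk_of_span {M : Matroid α} {x : α → W}
    (hx : ∀ I ⊆ M.E, M.Indep I ↔ LinearIndepOn K x I) {k : ℕ} {e : Fin k → α}
    (he : ∀ i, e i ∈ M.E) (hli : LinearIndependent K (x ∘ e)) :
    M.Indep (Set.range e) ∧
    M.IsFlat {f ∈ M.E | x f ∈ Submodule.span K (Set.range (x ∘ e))} ∧
      M.eRk {f ∈ M.E | x f ∈ Submodule.span K (Set.range (x ∘ e))} = k := by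
  have hinj : Function.Injective e := hli.injective.of_comp
  have hE : Set.range e ⊆ M.E := by rintro _ ⟨i, rfl⟩; exact he i
  have hliI : LinearIndepOn K x (Set.range e) := (linearIndepOn_range_iff hinj x).2 hli
  have hI : M.Indep (Set.range e) := (hx _ hE).2 hliI
  have hcl : M.closure (Set.range e) =
      {f ∈ M.E | x f ∈ Submodule.span K (Set.range (x ∘ e))} := by
    ext f
    rw [hI.mem_closure_iff', Set.mem_sep_iff]
    refine and_congr_right fun hf => ?_
    rw [hx _ (Set.insert_subset hf hE), linearIndepOn_insert_iff, Set.range_comp]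
    constructor
    · intro h
      by_contra hn
      exact hn (Submodule.subset_span (Set.mem_image_of_mem x (h ⟨hliI, fun h' => absurd h' hn⟩)))
    · exact fun h h' => h'.2 h
  rw [← hcl]
  refine ⟨hI, M.isFlat_closure _, ?_⟩
  rw [eRk_closure_eq, hI.eRk_eq_encard, ← Set.image_univ, hinj.encard_image, Set.encard_univ]
  simp

/-- A restriction to a subspace is determined by the projective points that it occupies. -/
theorem isIsomorphic_projectiveGeometry_restrict {M : Matroid α} (hM : M.IsSimple) {x : α → W}
    (hx : ∀ I ⊆ M.E, M.Indep I ↔ LinearIndepOn K x I) {n : ℕ} {v : Fin (n + 1) → W}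
    (hv : LinearIndependent K v) (Q : Set (ℙ K (Fin (n + 1) → K)))
    (hQ : ∀ (a : Fin (n + 1) → K) (ha : a ≠ 0),
      ∑ i, a i • v i ∈ M.representedVectors K x ↔ Projectivization.mk K a ha ∈ Q) :
    (M ↾ {f ∈ M.E | x f ∈ Submodule.span K (Set.range v)}).IsIsomorphic
      (projectiveGeometry n K ↾ Q) := by
  let T : (Fin (n + 1) → K) →ₗ[K] W := Fintype.linearCombination K v
  have hT : Function.Injective T := hv.fintypeLinearCombination_injective
  have hTa : ∀ a, T a = ∑ i, a i • v i := fun a => Fintype.linearCombination_apply K v a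
  let F : Set α := {f ∈ M.E | x f ∈ Submodule.span K (Set.range v)}
  have hF : ∀ f : F, ∃ a, T a = x f := fun f => by
    simpa [hTa] using (Submodule.mem_span_range_iff_exists_fun K).1 f.2.2
  choose a ha using hF
  have ha0 : ∀ f, a f ≠ 0 := fun f h => hM.vector_ne_zero hx f.2.1 (by rw [← ha, h, map_zero])
  have haQ : ∀ f, Projectivization.mk K (a f) (ha0 f) ∈ Q := fun f =>
    (hQ _ _).1 ⟨f, f.2.1, 1, one_ne_zero, by rw [← hTa, ha, one_smul]⟩
  let φ : F → Q := fun f => ⟨Projectivization.mk K (a f) (ha0 f), haQ f⟩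
  have hφ : Function.Bijective φ := by
    constructor
    · intro f g h
      obtain ⟨c, hc⟩ := (Projectivization.mk_eq_mk_iff' K _ _ _ _).1 (congrArg Subtype.val h)
      refine Subtype.ext (hM.eq_of_eq_smul hx f.2.1 g.2.1 (c := c) ?_)
      rw [← ha, ← ha, ← hc, map_smul]
    · rintro ⟨P, hP⟩
      obtain ⟨f, hf, c, hc, hfc⟩ := (hQ P.rep P.rep_nonzero).2 (by rwa [P.mk_rep])
      have hxf : x f = c⁻¹ • T P.rep := by rw [hTa, hfc, inv_smul_smul₀ hc]
      have hfF : f ∈ F := ⟨hf, by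
        rw [hxf, hTa]
        exact Submodule.smul_mem _ _ (Submodule.sum_mem _ fun i _ =>
          Submodule.smul_mem _ _ (Submodule.subset_span ⟨i, rfl⟩))⟩
      refine ⟨⟨f, hfF⟩, Subtype.ext (Eq.trans ?_ P.mk_rep)⟩
      have : a ⟨f, hfF⟩ = c⁻¹ • P.rep := hT (by rw [ha, map_smul, hxf])
      exact (Projectivization.mk_eq_mk_iff' K _ _ _ _).2 ⟨c⁻¹, this.symm⟩
  refine ⟨Equiv.ofBijective φ hφ, fun I => ?_⟩
  change Set F at I
  have h1 : (Subtype.val '' I : Set α) = Set.range fun i : I => (i.1 : α) := by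
    rw [Set.image_eq_range]
  have h2 : (Subtype.val '' (φ '' I) : Set (ℙ K (Fin (n + 1) → K))) =
      Set.range fun i : I => (φ i.1 : ℙ K (Fin (n + 1) → K)) := by
    rw [← Set.image_comp, Set.image_eq_range]; rfl
  have i1 : Function.Injective fun i : I => (i.1 : α) :=
    Subtype.val_injective.comp Subtype.val_injective
  have i2 : Function.Injective fun i : I => (φ i.1 : ℙ K (Fin (n + 1) → K)) :=
    Subtype.val_injective.comp (hφ.1.comp Subtype.val_injective)
  -- The chosen representative of a projective point is a unit multiple of `a f`, which does not
  -- affect independence.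
  choose u hu using fun f => Projectivization.exists_smul_eq_mk_rep K (a f) (ha0 f)
  change (M ↾ F).Indep (Subtype.val '' I) ↔
    (projectiveGeometry n K ↾ Q).Indep (Subtype.val '' (φ '' I))
  have hsub1 : (Subtype.val '' I : Set α) ⊆ F := by rintro _ ⟨f, -, rfl⟩; exact f.2
  have hsub2 : (Subtype.val '' (φ '' I) : Set (ℙ K (Fin (n + 1) → K))) ⊆ Q := by
    rintro _ ⟨f, -, rfl⟩; exact f.2
  rw [restrict_indep_iff, restrict_indep_iff, and_iff_left hsub1, and_iff_left hsub2,
    hx _ (hsub1.trans fun f hf => hf.1), projectiveGeometry, vectorMatroid_indep_iff, h1, h2,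
    linearIndepOn_range_iff i1, linearIndepOn_range_iff i2]
  have e1 : (x ∘ fun i : I => (i.1 : α)) = T ∘ fun i : I => a i.1 := funext fun i => (ha i.1).symm
  have e2 : ((fun P : ℙ K (Fin (n + 1) → K) => P.rep) ∘ fun i : I => (φ i.1).1) =
      (fun i : I => u i.1) • fun i : I => a i.1 := funext fun i => (hu i.1).symm
  rw [e1, e2, LinearIndependent.units_smul_iff]
  exact LinearMap.linearIndependent_iff T (LinearMap.ker_eq_bot.2 hT)

end Representation

section PrimeField

variable {α : Type u} {p : ℕ} [Fact p.Prime] {W : Type w} [AddCommGroup W] [Module (ZMod p) W]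

/-- An element in the span of a violating family has exactly one nonzero coefficient, so it is
parallel, hence by simplicity equal, to a member of the family. -/
theorem exists_indep_flat_of_not_combinationRich {M : Matroid α} (hM : M.IsSimple) {x : α → W}
    (hx : ∀ I ⊆ M.E, M.Indep I ↔ LinearIndepOn (ZMod p) x I) {t : ℕ}
    (h : ¬ CombinationRich (p := p) t (M.representedVectors (ZMod p) x)) :
    ∃ F : Set α, M.IsFlat F ∧ M.eRk F = (t : ℕ∞) ∧ M.Indep F := by
  simp only [CombinationRich, not_forall, not_exists, not_and] at h
  obtain ⟨y, hy, hyX, hc⟩ := h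
  choose e he c hc0 hye using hyX
  have hxe : x ∘ e = (fun i => (Units.mk0 (c i) (hc0 i))⁻¹) • y := by
    funext i
    simp [hye, Units.smul_def, smul_smul, hc0 i]
  have hli : LinearIndependent (ZMod p) (x ∘ e) := by
    rw [hxe]
    exact (LinearIndependent.units_smul_iff _ _).2 hy
  obtain ⟨hI, hflat, hrk⟩ := isFlat_eRk_of_span hx he hli
  refine ⟨_, hflat, hrk, hI.subset ?_⟩
  rintro f ⟨hf, hfe⟩
  obtain ⟨m, hm⟩ := (Submodule.mem_span_range_iff_exists_fun _).1 hfe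
  have hxf0 := hM.vector_ne_zero hx hf
  obtain ⟨i, hi⟩ : ∃ i, m i ≠ 0 := by
    by_contra! h0
    exact hxf0 (by rw [← hm]; simp [h0])
  have huniq : ∀ j, j ≠ i → m j = 0 := by
    intro j hj
    by_contra hmj
    refine hc (fun j => m j * (c j)⁻¹) ⟨j, i, hj, ?_, ?_⟩ ⟨f, hf, 1, one_ne_zero, ?_⟩
    · exact mul_ne_zero hmj (inv_ne_zero (hc0 j))
    · exact mul_ne_zero hi (inv_ne_zero (hc0 i))
    · rw [one_smul, ← hm]
      refine Finset.sum_congr rfl fun j _ => ?_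
      rw [hye, smul_smul, mul_assoc, inv_mul_cancel₀ (hc0 j), mul_one, Function.comp_apply]
  rw [Finset.sum_eq_single i (fun j _ hj => by rw [huniq j hj, zero_smul]) (by simp)] at hm
  exact ⟨i, (hM.eq_of_eq_smul hx hf (he i) hm.symm).symm⟩

theorem exists_independent_family {M : Matroid α} {x : α → W}
    (hx : ∀ I ⊆ M.E, M.Indep I ↔ LinearIndepOn (ZMod p) x I) {N : ℕ}
    (hN : (N : ℕ∞) ≤ M.eRank) :
    ∃ b : Fin N → W, LinearIndependent (ZMod p) b ∧
      ∀ i, b i ∈ M.representedVectors (ZMod p) x := by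
  obtain ⟨B, hB⟩ := M.exists_isBase
  rw [← hB.encard_eq_eRank] at hN
  obtain ⟨S, hSB, hS⟩ := Set.exists_subset_encard_eq hN
  have hfin : S.Finite := Set.finite_of_encard_eq_coe hS
  have hcard : Nat.card S = N := by
    rw [Nat.card_coe_set_eq, Set.ncard, hS, ENat.toNat_natCast]
  have : Finite S := hfin
  let φ : Fin N ≃ S := (Finite.equivFinOfCardEq hcard).symm
  have hSE : S ⊆ M.E := hSB.trans hB.subset_ground
  have hli : LinearIndepOn (ZMod p) x S := (hx S hSE).1 (hB.indep.subset hSB)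
  exact ⟨fun i => x (φ i), hli.linearIndependent.comp φ φ.injective,
    fun i => ⟨φ i, hSE (φ i).2, 1, one_ne_zero, (one_smul _ _).symm⟩⟩

theorem exists_geometry_flat {M : Matroid α} (hM : M.IsSimple) {x : α → W}
    (hx : ∀ I ⊆ M.E, M.Indep I ↔ LinearIndepOn (ZMod p) x I) {k : ℕ} {z : W} {y : Fin k → W}
    (hy : LinearIndependent (ZMod p) y) (hz : z ∉ Submodule.span (ZMod p) (Set.range y))
    (hzX : ∀ u ∈ Submodule.span (ZMod p) (Set.range y),
      z + u ∈ M.representedVectors (ZMod p) x)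
    (hyX : (∀ u ∈ Submodule.span (ZMod p) (Set.range y), u ≠ 0 →
        u ∈ M.representedVectors (ZMod p) x) ∨
      ∀ u ∈ Submodule.span (ZMod p) (Set.range y), u ≠ 0 →
        u ∉ M.representedVectors (ZMod p) x) :
    ∃ F : Set α, M.IsFlat F ∧ M.eRk F = ((k + 1 : ℕ) : ℕ∞) ∧
      ((M ↾ F).IsIsomorphic (affineGeometry k (ZMod p)) ∨
        (M ↾ F).IsIsomorphic (projectiveGeometry k (ZMod p))) := by
  let v : Fin (k + 1) → W := Fin.cons z y
  have hv : LinearIndependent (ZMod p) v := linearIndependent_finCons.2 ⟨hy, hz⟩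
  -- The vectors `y i` need not lie in `X`, so the basis of the flat is taken from `z` and the `z +
  -- y i`, which do.
  let s : Fin (k + 1) → W := Fin.cons 0 y
  have hs : ∀ i, s i ∈ Submodule.span (ZMod p) (Set.range y) := by
    intro i
    refine Fin.cases (Submodule.zero_mem _) (fun i => Submodule.subset_span ⟨i, rfl⟩) i
  choose e he c hc hec using fun i => hzX (s i) (hs i)
  have hxe : ∀ i, x (e i) = (c i)⁻¹ • (z + s i) := fun i => by
    rw [hec, inv_smul_smul₀ (hc i)]
  have hyv : Submodule.span (ZMod p) (Set.range y) ≤ Submodule.span (ZMod p) (Set.range v) :=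
    Submodule.span_mono (by rintro _ ⟨i, rfl⟩; exact ⟨i.succ, rfl⟩)
  have hspan : Submodule.span (ZMod p) (Set.range (x ∘ e)) =
      Submodule.span (ZMod p) (Set.range v) := by
    apply le_antisymm
    · rw [Submodule.span_le]
      rintro _ ⟨i, rfl⟩
      rw [Function.comp_apply, hxe]
      exact Submodule.smul_mem _ _ (Submodule.add_mem _ (Submodule.subset_span ⟨0, rfl⟩)
        (hyv (hs i)))
    · have hmem : ∀ i, z + s i ∈ Submodule.span (ZMod p) (Set.range (x ∘ e)) := fun i => by
        rw [hec]
        exact Submodule.smul_mem _ _ (Submodule.subset_span ⟨i, rfl⟩)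
      have hz0 : z ∈ Submodule.span (ZMod p) (Set.range (x ∘ e)) := by
        simpa [s] using hmem 0
      rw [Submodule.span_le]
      rintro _ ⟨i, rfl⟩
      refine Fin.cases hz0 (fun i => ?_) i
      simpa [s, v] using Submodule.sub_mem _ (hmem i.succ) hz0
  have hli : LinearIndependent (ZMod p) (x ∘ e) := by
    rw [linearIndependent_iff_card_eq_finrank_span, Set.finrank, hspan,
      finrank_span_eq_card hv]
  obtain ⟨-, hflat, hrk⟩ := isFlat_eRk_of_span hx he hli
  rw [hspan] at hflat hrk
  refine ⟨_, hflat, hrk, ?_⟩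
  have hsum : ∀ a : Fin (k + 1) → ZMod p,
      ∑ i, a i • v i = a 0 • z + ∑ i : Fin k, a i.succ • y i := fun a => by
    rw [Fin.sum_univ_succ]; rfl
  have htail : ∀ a : Fin (k + 1) → ZMod p, ∑ i : Fin k, a i.succ • y i ∈
      Submodule.span (ZMod p) (Set.range y) := fun a =>
    Submodule.sum_mem _ fun i _ => Submodule.smul_mem _ _ (Submodule.subset_span ⟨i, rfl⟩)
  have hne : ∀ a : Fin (k + 1) → ZMod p, a ≠ 0 → ∑ i, a i • v i ≠ 0 := fun a ha h =>
    ha (funext (Fintype.linearIndependent_iff.1 hv a h))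
  have haff : ∀ a : Fin (k + 1) → ZMod p, a 0 ≠ 0 →
      ∑ i, a i • v i ∈ M.representedVectors (ZMod p) x := by
    intro a ha
    obtain ⟨f, hf, d, hd, hfd⟩ := hzX ((a 0)⁻¹ • ∑ i : Fin k, a i.succ • y i)
      (Submodule.smul_mem _ _ (htail a))
    refine ⟨f, hf, a 0 * d, mul_ne_zero ha hd, ?_⟩
    rw [hsum, mul_smul, ← hfd, smul_add, smul_inv_smul₀ ha]
  rcases hyX with hyX | hyX
  · right
    have := isIsomorphic_projectiveGeometry_restrict hM hx hv Set.univ (fun a ha => by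
      simp only [Set.mem_univ, iff_true]
      by_cases h0 : a 0 = 0
      · have h := hne a ha
        rw [hsum, h0, zero_smul, zero_add] at h ⊢
        exact hyX _ (htail a) h
      · exact haff a h0)
    rwa [show (Set.univ : Set (ℙ (ZMod p) (Fin (k + 1) → ZMod p))) =
      (projectiveGeometry k (ZMod p)).E from rfl, restrict_ground_eq_self] at this
  · left
    refine isIsomorphic_projectiveGeometry_restrict hM hx hv _ (fun a ha => ?_)
    obtain ⟨d, hd⟩ := Projectivization.exists_smul_eq_mk_rep (ZMod p) a ha
    have h0 : (Projectivization.mk (ZMod p) a ha).rep 0 ≠ 0 ↔ a 0 ≠ 0 := by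
      rw [← hd, Pi.smul_apply, Units.smul_def, smul_eq_mul]
      simp
    rw [Set.mem_ofPred_eq, h0]
    refine ⟨fun h h0 => ?_, haff a⟩
    have h' := hne a ha
    rw [hsum, h0, zero_smul, zero_add] at h h'
    exact hyX _ (htail a) h' h

end PrimeField

/-- A simple `GF(p)`-representable matroid of large rank has an independent flat of rank `t` or a
flat of rank `k` that is an affine or projective geometry. -/
theorem exists_indep_flat_or_geometry (p : ℕ) [Fact p.Prime] (k t : ℕ) (hk : 1 ≤ k) :
    ∃ N : ℕ, ∀ (α : Type u) (M : Matroid α),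
      M.IsSimple → M.IsRepresentable (ZMod p) → (N : ℕ∞) ≤ M.eRank →
        (∃ F : Set α, M.IsFlat F ∧ M.eRk F = (t : ℕ∞) ∧ M.Indep F) ∨
        (∃ F : Set α, M.IsFlat F ∧ M.eRk F = (k : ℕ∞) ∧
          ((M ↾ F).IsIsomorphic (affineGeometry (k - 1) (ZMod p)) ∨
            (M ↾ F).IsIsomorphic (projectiveGeometry (k - 1) (ZMod p)))) := by
  obtain ⟨k, rfl⟩ := Nat.exists_eq_add_of_le' hk
  obtain ⟨N, hN⟩ := CombinationRich.exists_geometry.{u} (p := p) t k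
  refine ⟨N, fun α M hM ⟨W, _, _, x, hx⟩ hr => ?_⟩
  by_cases h : CombinationRich (p := p) t (M.representedVectors (ZMod p) x)
  · obtain ⟨b, hb, hbX⟩ := exists_independent_family hx hr
    obtain ⟨z, y, hy, hz, hzX, hyX⟩ := hN W _ (by
      rintro c _ hc ⟨f, hf, d, hd, rfl⟩
      exact ⟨f, hf, c * d, mul_ne_zero hc hd, smul_smul _ _ _⟩) h b hb hbX
    exact Or.inr (exists_geometry_flat hM hx hy hz hzX hyX)
  · exact Or.inl (exists_indep_flat_of_not_combinationRich hM hx h)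

end Matroid

theorem mainTheorem1 (p : ℕ) [Fact p.Prime] :
    (∀ k : ℕ, 1 ≤ k → ∃ N : ℕ, ∀ (α : Type u) (M : Matroid α),
      M.IsSimple → M.IsRepresentable (ZMod p) → (N : ℕ∞) ≤ M.eRank →
        ∃ F : Set α, M.IsFlat F ∧ M.eRk F = (k : ℕ∞) ∧
          (M.Indep F ∨
            (M ↾ F).IsIsomorphic (Matroid.affineGeometry (k - 1) (ZMod p)) ∨
            (M ↾ F).IsIsomorphic (Matroid.projectiveGeometry (k - 1) (ZMod p)))) ∧
    (∀ k t : ℕ, 1 ≤ k → 1 ≤ t → ∃ N : ℕ, ∀ (α : Type u) (M : Matroid α),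
      M.IsSimple → M.IsRepresentable (ZMod p) → (N : ℕ∞) ≤ M.eRank →
        (∃ F : Set α, M.IsFlat F ∧ M.eRk F = (t : ℕ∞) ∧ M.Indep F) ∨
        (∃ F : Set α, M.IsFlat F ∧ M.eRk F = (k : ℕ∞) ∧
          ((M ↾ F).IsIsomorphic (Matroid.affineGeometry (k - 1) (ZMod p)) ∨
            (M ↾ F).IsIsomorphic (Matroid.projectiveGeometry (k - 1) (ZMod p))))) := by
  refine ⟨fun k hk => ?_, fun k t hk _ => Matroid.exists_indep_flat_or_geometry p k t hk⟩
  -- The first statement is the second with `t = k`.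
  obtain ⟨N, hN⟩ := Matroid.exists_indep_flat_or_geometry.{u} p k k hk
  refine ⟨N, fun α M hM hrep hr => ?_⟩
  rcases hN α M hM hrep hr with ⟨F, hF, hrk, hI⟩ | ⟨F, hF, hrk, hiso⟩
  · exact ⟨F, hF, hrk, Or.inl hI⟩
  · exact ⟨F, hF, hrk, Or.inr hiso⟩
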